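/- A mixed graph is a finite graph without loops in which any two distinct vertices are joined by at most one object, either a directed arc or an undirected edge. Its order is the number of its vertices, and its size is the number of its arcs plus twice the number of its undirected edges. Its underlying graph is obtained by removing the directions on the arcs. It is a mixed tree if its underlying graph is a tree, and a mixed star if its underlying graph is a tree of diameter at most $2$. The out-degree $d_i^+$ of a vertex $i$ is the number of vertices $j$ such that there is an arc from $i$ to $j$ or an undirected edge $ij$. The adjacency matrix $A=(a_{ij})$ is the $01$-matrix with $a_{ij}=1$ if and only if there is an arc from $i$ to $j$ or an undirected edge $ij$; put $D^+=\mathrm{diag}(d_i^+)$. For $\alpha\in[0,1]$ let $A_\alpha=\alpha D^++(1-\alpha)A$, and let the $A_\alpha$-spectral radius $\rho_\alpha$ be the largest real eigenvalue of $A_\alpha$. **Theorem.** Let $\alpha\in[0,1]$ and let $T$ be a mixed tree of order $n$ and size $m$. Then the largest real eigenvalue $\rho_\alpha(T)$ of $A_\alpha(T)$ exists and $$\rho_\alpha(T)\le\frac12\left(\alpha n+\sqrt{\alpha^2n^2-4\alpha^2(n-1)+4(1-\alpha)^2(m-n+1)}\right).$$ Moreover, if $n\ge 2$, every mixed star of order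 $n$ and size $m$ with maximum out-degree $n-1$ attains the upper bound, that is, equality holds for it. -/

import Mathlib

/-- A mixed graph on the vertex set `V`: a loopless graph in which any two distinct vertices are
joined by at most one object, which is either a directed arc or an undirected edge. -/
structure MixedGraph (V : Type*) where
  /-- `Arc i j`: there is a directed arc from `i` to `j`. -/
  Arc : V → V → Prop
  /-- The simple graph formed by the undirected edges. -/
  undirected : SimpleGraph V
  /-- There are no directed loops. -/
  arc_irrefl : ∀ i, ¬ Arc i i
  /-- Two vertices are not joined by two opposite arcs. -/
  arc_asymm : ∀ i j, Arc i j → ¬ Arc j i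
  /-- Two vertices are not joined both by an arc and by an undirected edge. -/
  arc_not_undirected : ∀ i j, Arc i j → ¬ undirected.Adj i j

namespace MixedGraph

variable {V : Type*}

/-- `G.Out i j`: there is an arc from `i` to `j` or an undirected edge between `i` and `j`,
that is, `j` is an out-neighbour of `i`. -/
def Out (G : MixedGraph V) (i j : V) : Prop :=
  G.Arc i j ∨ G.undirected.Adj i j

/-- The underlying graph, obtained by removing the directions on the arcs. -/
def underlying (G : MixedGraph V) : SimpleGraph V where
  Adj i j := G.Arc i j ∨ G.Arc j i ∨ G.undirected.Adj i j
  symm := ⟨by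
    rintro i j (h | h | h)
    · exact Or.inr (Or.inl h)
    · exact Or.inl h
    · exact Or.inr (Or.inr h.symm)⟩
  loopless := ⟨by
    rintro i (h | h | h)
    · exact G.arc_irrefl i h
    · exact G.arc_irrefl i h
    · exact G.undirected.irrefl h⟩

/-- A mixed tree is a mixed graph whose underlying graph is a tree. -/
def IsMixedTree (G : MixedGraph V) : Prop :=
  G.underlying.IsTree

/-- A mixed star is a mixed graph whose underlying graph is a star: a tree of diameter
at most two. -/
def IsMixedStar (G : MixedGraph V) : Prop :=
  G.underlying.IsTree ∧ G.underlying.ediam ≤ 2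

/-- The size: the number of arcs plus twice the number of undirected edges. -/
noncomputable def size (G : MixedGraph V) : ℕ :=
  {p : V × V | G.Arc p.1 p.2}.ncard + 2 * G.undirected.edgeSet.ncard

/-- The out-degree of a vertex. -/
noncomputable def outDegree (G : MixedGraph V) (i : V) : ℕ :=
  {j : V | G.Out i j}.ncard

/-- The maximum out-degree. -/
noncomputable def maxOutDegree [Fintype V] (G : MixedGraph V) : ℕ :=
  Finset.univ.sup G.outDegree

open Classical in
/-- The adjacency matrix. -/
noncomputable def adjMatrix (G : MixedGraph V) : Matrix V V ℝ :=
  Matrix.of fun i j => if G.Out i j then 1 else 0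

/-- The diagonal matrix of out-degrees. -/
noncomputable def outDegreeMatrix [DecidableEq V] (G : MixedGraph V) : Matrix V V ℝ :=
  Matrix.diagonal fun i => (G.outDegree i : ℝ)

/-- The matrix `A_α = α D⁺ + (1 - α) A`. -/
noncomputable def alphaMatrix [DecidableEq V] (G : MixedGraph V) (α : ℝ) : Matrix V V ℝ :=
  α • G.outDegreeMatrix + (1 - α) • G.adjMatrix

/-- The set of real eigenvalues of `A_α`. -/
def alphaEigenvalues [Fintype V] [DecidableEq V] (G : MixedGraph V) (α : ℝ) : Set ℝ :=
  {μ : ℝ | Module.End.HasEigenvalue (Matrix.toLin' (G.alphaMatrix α)) μ}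

/-- The `A_α`-spectral radius `ρ_α`: the largest real eigenvalue of `A_α`. -/
noncomputable def alphaSpectralRadius [Fintype V] [DecidableEq V] (G : MixedGraph V) (α : ℝ) : ℝ :=
  sSup (G.alphaEigenvalues α)

end MixedGraph

/-!
Write `u` for the number of undirected edges, `β = 1 - α`, and `B` for the claimed bound. Counting
gives `u = m - n + 1`, and `B` is the larger root of `(B - α (n - 1)) (B - α) = β² u`.

*Symmetrisation.* An arc of a mixed tree lies on no closed walk, so deleting the entries of the arcs
from `(1 - α) A`, while keeping the diagonal `α D⁺`, does not change the characteristic polynomial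
(`IsMixedTree.charpoly_alphaMatrix`). The result `S` is symmetric; hence `A_α` has a largest real
eigenvalue, and it suffices to bound the quadratic form of `S`.

*Upper bound.* Let `p ≥ q` be the sums of the `x i ^ 2` over the two colour classes of the tree.
The out-degrees of two vertices add up to at most `n`, which gives
`∑ i, d i * x i ^ 2 ≤ (n - 1) p + q` (`IsMixedTree.sum_outDegree_mul_le`). Undirected edges join
different classes, so by Cauchy–Schwarz they contribute at most `2 β √(u p q)`
(`sq_sum_undirected_le`). By AM-GM, `α ((n - 1) p + q) + 2 β √(u p q) ≤ B (p + q)`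
(`add_mul_le_treeBound`).

*Sharpness.* If some vertex has out-degree `n - 1`, an explicit eigenvector supported on it and on
its undirected neighbours has eigenvalue `B` (`IsMixedTree.treeBound_mem`).
-/

/-! ### Trees -/

namespace SimpleGraph

/-- On a tree, every antisymmetric weight on ordered pairs of vertices is, along the edges, the
difference of a vertex potential: sum the weights along the path from a fixed root. -/
theorem IsTree.exists_potential {V M : Type*} [AddCommGroup M] {G : SimpleGraph V}
    (hG : G.IsTree) (w : V → V → M) (hw : ∀ u v, w v u = -w u v) :
    ∃ b : V → M, ∀ u v, G.Adj u v → b v = b u + w u v := by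
  classical
  obtain ⟨r⟩ := hG.connected.nonempty
  choose P hP _ using fun v => hG.existsUnique_path r v
  have key : ∀ u v, ∀ h : G.Adj u v, P v = (P u).concat h →
      ((P v).darts.map fun d => w d.fst d.snd).sum =
        ((P u).darts.map fun d => w d.fst d.snd).sum + w u v := by
    intro u v h e
    rw [e]
    simp [Walk.darts_concat]
  refine ⟨fun v => ((P v).darts.map fun d => w d.fst d.snd).sum, fun u v h => ?_⟩
  by_cases hu : u ∈ (P v).support
  · exact key u v h (hG.isAcyclic.path_concat (hP u) (hP v) h hu)
  · have hv : v ∈ (P u).support :=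
      hG.isAcyclic.mem_support_of_ne_mem_support_of_adj_of_isPath (hP u) (hP v) h hu
    have := key v u h.symm (hG.isAcyclic.path_concat (hP v) (hP u) h.symm hv)
    simp only [this, hw u v]
    abel

/-- The edge sets at two distinct vertices share at most one of the `|V| - 1` edges. -/
theorem IsTree.degree_add_degree_le {V : Type*} [Fintype V] {G : SimpleGraph V}
    [DecidableRel G.Adj] (hG : G.IsTree) {i j : V} (hij : i ≠ j) :
    G.degree i + G.degree j ≤ Fintype.card V := by
  classical
  have h1 := Finset.card_union_add_card_inter (G.incidenceFinset i) (G.incidenceFinset j)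
  have h2 : (G.incidenceFinset i ∪ G.incidenceFinset j).card ≤ G.edgeFinset.card :=
    Finset.card_le_card
      (Finset.union_subset (G.incidenceFinset_subset i) (G.incidenceFinset_subset j))
  have h3 : (G.incidenceFinset i ∩ G.incidenceFinset j).card ≤ 1 := by
    refine (Finset.card_le_card (t := {s(i, j)}) fun e he => ?_).trans (by simp)
    rw [Finset.mem_inter, mem_incidenceFinset, mem_incidenceFinset] at he
    simpa using G.incidenceSet_inter_incidenceSet_subset hij he
  have h4 := hG.card_edgeFinset
  simp only [card_incidenceFinset_eq_degree] at h1
  omega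

end SimpleGraph

namespace MixedGraph

open Finset

variable {V : Type*}

/-! ### Counting arcs and edges -/

theorem Out.underlying_adj {T : MixedGraph V} {i j : V} (h : T.Out i j) : T.underlying.Adj i j :=
  h.elim Or.inl fun h => Or.inr (Or.inr h)

open Classical in
theorem outDegree_eq_sum [Fintype V] (T : MixedGraph V) (i : V) :
    T.outDegree i = ∑ j, if T.Out i j then 1 else 0 := by
  rw [outDegree, Set.ncard_eq_toFinset_card', sum_boole]
  simp

open Classical in
theorem outDegree_le_degree [Fintype V] (T : MixedGraph V) (i : V) :
    T.outDegree i ≤ T.underlying.degree i := by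
  rw [outDegree, Set.ncard_eq_toFinset_card', ← SimpleGraph.card_neighborFinset_eq_degree]
  refine card_le_card fun j hj => ?_
  simpa using Out.underlying_adj (by simpa using hj)

open Classical in
theorem sum_undirected [Fintype V] (T : MixedGraph V) :
    ∑ i, ∑ j, (if T.undirected.Adj i j then 1 else 0) = 2 * T.undirected.edgeSet.ncard := by
  rw [Set.ncard_eq_toFinset_card', ← SimpleGraph.edgeFinset,
    ← SimpleGraph.sum_degrees_eq_twice_card_edges]
  refine sum_congr rfl fun i _ => ?_
  rw [sum_boole, ← SimpleGraph.card_neighborFinset_eq_degree, SimpleGraph.neighborFinset_eq_filter]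
  simp

open Classical in
theorem sum_arc [Fintype V] (T : MixedGraph V) :
    ∑ i, ∑ j, (if T.Arc i j then 1 else 0) = {p : V × V | T.Arc p.1 p.2}.ncard := by
  rw [Set.ncard_eq_toFinset_card',
    ← Fintype.sum_prod_type' (f := fun i j => if T.Arc i j then 1 else 0), sum_boole]
  simp

open Classical in
theorem sum_outDegree [Fintype V] (T : MixedGraph V) : ∑ i, T.outDegree i = T.size := by
  rw [size, ← sum_arc, ← sum_undirected, ← sum_add_distrib]
  refine sum_congr rfl fun i _ => ?_
  rw [outDegree_eq_sum, ← sum_add_distrib]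
  refine sum_congr rfl fun j _ => ?_
  have := T.arc_not_undirected i j
  by_cases h1 : T.Arc i j <;> by_cases h2 : T.undirected.Adj i j <;> simp_all [Out]

open Classical in
/-- The number of undirected edges of a mixed tree is `m - n + 1`: both `∑ i, deg i = 2 (n - 1)` and
`m` are counted through arcs and undirected edges. -/
theorem IsMixedTree.size_add_one [Fintype V] {T : MixedGraph V} (hT : T.IsMixedTree) :
    T.size + 1 = Fintype.card V + T.undirected.edgeSet.ncard := by
  have h1 := SimpleGraph.IsTree.card_edgeFinset hT
  have h2 := T.underlying.sum_degrees_eq_twice_card_edges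
  have h3 : ∑ i, T.underlying.degree i =
      ∑ i, ∑ j, (if T.Arc i j then 1 else 0) + ∑ i, ∑ j, (if T.Arc i j then 1 else 0) +
        ∑ i, ∑ j, (if T.undirected.Adj i j then 1 else 0) := by
    conv_rhs => enter [1, 2]; rw [sum_comm]
    rw [← sum_add_distrib, ← sum_add_distrib]
    refine sum_congr rfl fun i _ => ?_
    rw [← sum_add_distrib, ← sum_add_distrib, ← SimpleGraph.card_neighborFinset_eq_degree,
      SimpleGraph.neighborFinset_eq_filter, card_filter]
    refine sum_congr rfl fun j _ => ?_
    have a1 := T.arc_not_undirected i j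
    have a2 := T.arc_not_undirected j i
    have a3 := T.arc_asymm i j
    have a4 := T.undirected.adj_comm i j
    by_cases h1 : T.Arc i j <;> by_cases h2 : T.undirected.Adj i j <;>
      by_cases h3 : T.Arc j i <;> simp_all [underlying]
  rw [sum_arc, sum_undirected] at h3
  rw [size]
  omega

theorem IsMixedTree.outDegree_add_outDegree_le [Fintype V] {T : MixedGraph V}
    (hT : T.IsMixedTree) {i j : V} (hij : i ≠ j) :
    T.outDegree i + T.outDegree j ≤ Fintype.card V := by
  classical
  exact (add_le_add (T.outDegree_le_degree i) (T.outDegree_le_degree j)).trans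
    (SimpleGraph.IsTree.degree_add_degree_le hT hij)

theorem outDegree_lt_card [Fintype V] (T : MixedGraph V) (i : V) :
    T.outDegree i < Fintype.card V := by
  classical
  exact (T.outDegree_le_degree i).trans_lt (T.underlying.degree_lt_card_verts i)

/-! ### Reduction to a symmetric matrix -/

open Classical in
/-- The symmetric matrix obtained from `A_α` by deleting the entries of the directed arcs; the
out-degrees on the diagonal still count the arcs. -/
noncomputable def edgeAlphaMatrix [DecidableEq V] (T : MixedGraph V) (α : ℝ) : Matrix V V ℝ :=
  α • T.outDegreeMatrix + (1 - α) • Matrix.of fun i j => if T.undirected.Adj i j then 1 else 0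

theorem edgeAlphaMatrix_isHermitian [DecidableEq V] (T : MixedGraph V) (α : ℝ) :
    (T.edgeAlphaMatrix α).IsHermitian := by
  ext i j
  by_cases h : i = j
  · simp [h]
  · simp only [edgeAlphaMatrix, outDegreeMatrix, Matrix.conjTranspose_apply, Matrix.add_apply,
      Matrix.smul_apply, Matrix.diagonal_apply_ne _ h, Matrix.diagonal_apply_ne' _ h,
      Matrix.of_apply, star_trivial]
    by_cases hA : T.undirected.Adj i j
    · rw [if_pos hA, if_pos hA.symm]
    · rw [if_neg hA, if_neg fun hA' => hA hA'.symm]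

/-- In a mixed tree no arc lies on a closed walk, so both matrices are block triangular, with the
same diagonal blocks, for a vertex order that increases along arcs and is constant along edges. -/
theorem IsMixedTree.charpoly_alphaMatrix [Fintype V] [DecidableEq V] {T : MixedGraph V}
    (hT : T.IsMixedTree) (α : ℝ) :
    (T.alphaMatrix α).charpoly = (T.edgeAlphaMatrix α).charpoly := by
  classical
  obtain ⟨b, hb⟩ := SimpleGraph.IsTree.exists_potential hT
    (fun i j => (if T.Arc i j then (1 : ℤ) else 0) - if T.Arc j i then 1 else 0)
    (fun i j => by ring)
  have hArc : ∀ i j, T.Arc i j → b i < b j := by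
    intro i j h
    have := hb i j (Or.inl h)
    simp [h, T.arc_asymm i j h] at this
    omega
  have hEdge : ∀ i j, T.undirected.Adj i j → b i = b j := by
    intro i j h
    have := hb i j (Or.inr (Or.inr h))
    have h1 : ¬ T.Arc i j := fun h' => T.arc_not_undirected i j h' h
    have h2 : ¬ T.Arc j i := fun h' => T.arc_not_undirected j i h' h.symm
    simp [h1, h2] at this
    exact this.symm
  have hne : ∀ i j, b j < b i → i ≠ j := by rintro i _ h rfl; exact h.false
  have h1 : (T.alphaMatrix α).BlockTriangular b := by
    intro i j h
    have : ¬ T.Out i j := by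
      rintro (h' | h')
      · exact (hArc i j h').not_gt h
      · exact (hEdge i j h').not_gt h
    simp [alphaMatrix, outDegreeMatrix, adjMatrix, hne i j h, this]
  have h2 : (T.edgeAlphaMatrix α).BlockTriangular b := by
    intro i j h
    have : ¬ T.undirected.Adj i j := fun h' => (hEdge i j h').not_gt h
    simp [edgeAlphaMatrix, outDegreeMatrix, hne i j h, this]
  rw [h1.charpoly, h2.charpoly]
  refine prod_congr rfl fun a _ => ?_
  congr 1
  ext ⟨i, hi⟩ ⟨j, hj⟩
  have : ¬ T.Arc i j := fun h => (hArc i j h).ne (hi.trans hj.symm)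
  simp [Matrix.toSquareBlock_def, alphaMatrix, edgeAlphaMatrix, adjMatrix, Out, this]

theorem IsMixedTree.mem_alphaEigenvalues_iff [Fintype V] [DecidableEq V] {T : MixedGraph V}
    (hT : T.IsMixedTree) {α μ : ℝ} :
    μ ∈ T.alphaEigenvalues α ↔
      Module.End.HasEigenvalue (Matrix.toLin' (T.edgeAlphaMatrix α)) μ := by
  rw [alphaEigenvalues, Set.mem_ofPred_eq, Module.End.hasEigenvalue_iff_isRoot_charpoly,
    Module.End.hasEigenvalue_iff_isRoot_charpoly, Matrix.charpoly_toLin', Matrix.charpoly_toLin',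
    hT.charpoly_alphaMatrix]

theorem IsMixedTree.isGreatest_alphaSpectralRadius [Fintype V] [DecidableEq V] {T : MixedGraph V}
    (hT : T.IsMixedTree) (α : ℝ) :
    IsGreatest (T.alphaEigenvalues α) (T.alphaSpectralRadius α) := by
  have hfin : (T.alphaEigenvalues α).Finite := Module.End.finite_hasEigenvalue _
  obtain ⟨r⟩ := SimpleGraph.Connected.nonempty hT.connected
  have hS := T.edgeAlphaMatrix_isHermitian α
  have hne : (T.alphaEigenvalues α).Nonempty := by
    refine ⟨hS.eigenvalues r, hT.mem_alphaEigenvalues_iff.2 ?_⟩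
    refine Module.End.hasEigenvalue_of_hasEigenvector
      (x := ⇑(hS.eigenvectorBasis r)) ⟨Module.End.mem_eigenspace_iff.2 ?_, fun h => ?_⟩
    · rw [Matrix.toLin'_apply]
      exact hS.mulVec_eigenvectorBasis r
    · exact hS.eigenvectorBasis.orthonormal.ne_zero r (by ext i; exact congrFun h i)
  exact ⟨hne.csSup_mem hfin, fun x hx => le_csSup hfin.bddAbove hx⟩

/-! ### The quadratic form on a two-coloured tree -/

/-- Distribute a total mass `p + q` over the vertices, at most `p ≥ q` on each. As the out-degrees
of two vertices add up to at most `|V|`, the out-degree weighted mass is largest when `p` sits at a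
vertex of out-degree `|V| - 1` and `q` at vertices of out-degree one. -/
theorem IsMixedTree.sum_outDegree_mul_le [Fintype V] {T : MixedGraph V} (hT : T.IsMixedTree)
    (y : V → ℝ) (hy : ∀ i, 0 ≤ y i) {p q : ℝ} (hqp : q ≤ p) (hq : 0 ≤ q)
    (hsum : ∑ i, y i = p + q) (hle : ∀ i, y i ≤ p) :
    ∑ i, (T.outDegree i : ℝ) * y i ≤ (Fintype.card V - 1) * p + q := by
  classical
  have : Nonempty V := SimpleGraph.Connected.nonempty hT.connected
  obtain ⟨c, hc⟩ := Finite.exists_max T.outDegree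
  have hn : (1 : ℝ) ≤ Fintype.card V := by exact_mod_cast Fintype.card_pos
  have hcn : (T.outDegree c : ℝ) + 1 ≤ Fintype.card V := by
    exact_mod_cast T.outDegree_lt_card c
  rcases Nat.lt_or_ge 1 (Fintype.card V) with h1 | h1
  swap
  · have h0 : ∀ i, T.outDegree i = 0 := fun i => by have := T.outDegree_lt_card i; omega
    simp only [h0, Nat.cast_zero, zero_mul, sum_const_zero]
    nlinarith
  have h2 : (2 : ℝ) ≤ Fintype.card V := by exact_mod_cast h1
  rcases le_total (2 * (T.outDegree c : ℝ)) (Fintype.card V) with h | h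
  · have : ∑ i, (T.outDegree i : ℝ) * y i ≤ ∑ i, (Fintype.card V / 2 : ℝ) * y i := by
      refine sum_le_sum fun i _ => mul_le_mul_of_nonneg_right ?_ (hy i)
      have : (T.outDegree i : ℝ) ≤ T.outDegree c := by exact_mod_cast hc i
      linarith
    rw [← mul_sum, hsum] at this
    nlinarith
  · have : ∑ i ∈ univ.erase c, (T.outDegree i : ℝ) * y i ≤
        ∑ i ∈ univ.erase c, ((Fintype.card V : ℝ) - T.outDegree c) * y i := by
      refine sum_le_sum fun i hi => mul_le_mul_of_nonneg_right ?_ (hy i)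
      have : (T.outDegree i : ℝ) + T.outDegree c ≤ Fintype.card V := by
        exact_mod_cast hT.outDegree_add_outDegree_le (ne_of_mem_erase hi)
      linarith
    rw [← mul_sum] at this
    have e1 := add_sum_erase univ (fun i => (T.outDegree i : ℝ) * y i) (mem_univ c)
    have e2 := add_sum_erase univ y (mem_univ c)
    rw [hsum] at e2
    have e3 : ∑ i ∈ univ.erase c, y i = p + q - y c := by linarith
    rw [e3] at this
    nlinarith [mul_nonneg (sub_nonneg.2 h) (sub_nonneg.2 (hle c)),
      mul_nonneg (sub_nonneg.2 hcn) (sub_nonneg.2 hqp)]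

open Classical in
/-- Cauchy–Schwarz over the edges, all of which join the two colour classes. -/
theorem sq_sum_undirected_le [Fintype V] (T : MixedGraph V) (C : V → Prop)
    (hC : ∀ i j, T.undirected.Adj i j → (C i ↔ ¬ C j)) (x : V → ℝ) :
    (∑ i, ∑ j, (if T.undirected.Adj i j then 1 else 0) * (x i * x j)) ^ 2 ≤
      4 * T.undirected.edgeSet.ncard *
        ((∑ i, if C i then x i ^ 2 else 0) * ∑ i, if C i then 0 else x i ^ 2) := by
  set a : V × V → ℝ := fun z => if T.undirected.Adj z.1 z.2 then 1 else 0 with ha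
  set P : ℝ := ∑ i, if C i then x i ^ 2 else 0 with hP
  set Q : ℝ := ∑ i, if C i then 0 else x i ^ 2 with hQ
  have haa : ∀ z, a z ^ 2 = a z := fun z => by simp only [ha]; split_ifs <;> simp
  have h1 := sum_mul_sq_le_sq_mul_sq univ a (fun z => a z * (x z.1 * x z.2))
  have h2 : ∑ z, a z = 2 * T.undirected.edgeSet.ncard := by
    rw [Fintype.sum_prod_type]
    simp only [ha]
    exact_mod_cast T.sum_undirected
  have h3 : ∑ z, (a z * (x z.1 * x z.2)) ^ 2 ≤ 2 * (P * Q) := by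
    have e : 2 * (P * Q) = ∑ z : V × V,
        ((if C z.1 then x z.1 ^ 2 else 0) * (if C z.2 then 0 else x z.2 ^ 2) +
          (if C z.1 then 0 else x z.1 ^ 2) * (if C z.2 then x z.2 ^ 2 else 0)) := by
      rw [sum_add_distrib, Fintype.sum_prod_type, Fintype.sum_prod_type]
      simp only [← mul_sum, ← sum_mul, ← hP, ← hQ]
      ring
    rw [e]
    refine sum_le_sum fun z _ => ?_
    have hz := hC z.1 z.2
    by_cases hA : T.undirected.Adj z.1 z.2
    · by_cases h1 : C z.1 <;> by_cases h2 : C z.2 <;> simp_all [mul_pow]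
    · have : a z = 0 := by simp [ha, hA]
      rw [this]
      simp only [zero_mul, ne_eq, OfNat.ofNat_ne_zero, not_false_eq_true, zero_pow]
      split_ifs <;> positivity
  have h4 : ∑ z, a z * (a z * (x z.1 * x z.2)) =
      ∑ i, ∑ j, (if T.undirected.Adj i j then 1 else 0) * (x i * x j) := by
    rw [← Fintype.sum_prod_type'
      (f := fun i j => (if T.undirected.Adj i j then (1 : ℝ) else 0) * (x i * x j))]
    refine sum_congr rfl fun z _ => ?_
    rw [← mul_assoc, ← sq, haa]
  rw [h4] at h1
  simp only [haa, h2] at h1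
  refine h1.trans ?_
  calc _ ≤ 2 * (T.undirected.edgeSet.ncard : ℝ) * (2 * (P * Q)) := by gcongr
    _ = _ := by ring

/-! ### The bound -/

/-- The upper bound for `ρ_α` in terms of `n` and the number `u = m - n + 1` of undirected edges:
the larger root `B` of `(B - α (n - 1)) (B - α) = (1 - α)² u`. -/
noncomputable def treeBound (α n u : ℝ) : ℝ :=
  1 / 2 * (α * n + Real.sqrt (α ^ 2 * n ^ 2 - 4 * α ^ 2 * (n - 1) + 4 * (1 - α) ^ 2 * u))

theorem treeBound_sub_mul_sub {α n u : ℝ} (hu : 0 ≤ u) :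
    (treeBound α n u - α * (n - 1)) * (treeBound α n u - α) = (1 - α) ^ 2 * u := by
  have h : 0 ≤ α ^ 2 * n ^ 2 - 4 * α ^ 2 * (n - 1) + 4 * (1 - α) ^ 2 * u := by
    have : 0 ≤ (1 - α) ^ 2 * u := by positivity
    nlinarith [sq_nonneg (α * (n - 2))]
  have := Real.sq_sqrt h
  unfold treeBound
  nlinarith

theorem abs_mul_sub_two_le_sqrt {α n u : ℝ} (hu : 0 ≤ u) :
    |α * (n - 2)| ≤
      Real.sqrt (α ^ 2 * n ^ 2 - 4 * α ^ 2 * (n - 1) + 4 * (1 - α) ^ 2 * u) := by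
  refine Real.abs_le_sqrt ?_
  have : 0 ≤ (1 - α) ^ 2 * u := by positivity
  nlinarith

theorem mul_sub_one_le_treeBound {α n u : ℝ} (hu : 0 ≤ u) :
    α * (n - 1) ≤ treeBound α n u := by
  have := (le_abs_self _).trans (abs_mul_sub_two_le_sqrt (α := α) (n := n) hu)
  unfold treeBound
  linarith

theorem le_treeBound {α n u : ℝ} (hu : 0 ≤ u) : α ≤ treeBound α n u := by
  have := (neg_le_abs _).trans (abs_mul_sub_two_le_sqrt (α := α) (n := n) hu)
  unfold treeBound
  linarith

/-- `B` dominates the quadratic form of the symmetric matrix with diagonal entries `α (n - 1)`, `α`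
and off-diagonal entries `(1 - α) √u`, at the vector `(√p, √q)`. -/
theorem add_mul_le_treeBound {α n u p q s : ℝ} (hu : 0 ≤ u) (hp : 0 ≤ p) (hq : 0 ≤ q)
    (hs : s ^ 2 ≤ 4 * u * (p * q)) :
    α * ((n - 1) * p + q) + (1 - α) * s ≤ treeBound α n u * (p + q) := by
  have h1 := mul_sub_one_le_treeBound (α := α) (n := n) hu
  have h2 := le_treeBound (α := α) (n := n) hu
  have h3 := treeBound_sub_mul_sub (α := α) (n := n) hu
  set B := treeBound α n u
  -- AM-GM for `(B - α (n - 1)) p` and `(B - α) q`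
  have h4 : (1 - α) * s ≤ (B - α * (n - 1)) * p + (B - α) * q := by
    refine le_of_sq_le_sq ?_ ?_
    · calc ((1 - α) * s) ^ 2 = (1 - α) ^ 2 * s ^ 2 := by ring
        _ ≤ (1 - α) ^ 2 * (4 * u * (p * q)) := by gcongr
        _ = 4 * ((B - α * (n - 1)) * (B - α)) * (p * q) := by rw [h3]; ring
        _ ≤ _ := by nlinarith [sq_nonneg ((B - α * (n - 1)) * p - (B - α) * q)]
    · have := mul_nonneg (sub_nonneg.2 h1) hp
      have := mul_nonneg (sub_nonneg.2 h2) hq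
      linarith
  linarith

theorem IsMixedTree.le_treeBound_of_mem [Fintype V] [DecidableEq V] {T : MixedGraph V}
    (hT : T.IsMixedTree) {α μ : ℝ} (hα : α ∈ Set.Icc (0 : ℝ) 1)
    (hμ : μ ∈ T.alphaEigenvalues α) :
    μ ≤ treeBound α (Fintype.card V) T.undirected.edgeSet.ncard := by
  classical
  obtain ⟨x, hx⟩ := (hT.mem_alphaEigenvalues_iff.1 hμ).exists_hasEigenvector
  have hx0 := hx.2
  have hxe := hx.apply_eq_smul
  rw [Matrix.toLin'_apply] at hxe
  have hform : μ * ∑ i, x i ^ 2 = α * ∑ i, (T.outDegree i : ℝ) * x i ^ 2 +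
      (1 - α) * ∑ i, ∑ j, (if T.undirected.Adj i j then 1 else 0) * (x i * x j) := by
    rw [mul_sum, mul_sum, mul_sum, ← sum_add_distrib]
    refine sum_congr rfl fun i _ => ?_
    have h := congrFun hxe i
    rw [edgeAlphaMatrix, Matrix.add_mulVec, Matrix.smul_mulVec, Matrix.smul_mulVec, Pi.add_apply,
      Pi.smul_apply, Pi.smul_apply, Pi.smul_apply, outDegreeMatrix, Matrix.mulVec_diagonal,
      Matrix.mulVec, dotProduct] at h
    simp only [smul_eq_mul, Matrix.of_apply] at h
    rw [sq, ← mul_assoc, ← h, add_mul, mul_assoc (1 - α), sum_mul]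
    congr 1
    · ring
    · congr 1
      exact sum_congr rfl fun j _ => by ring
  have hpos : 0 < ∑ i, x i ^ 2 := by
    obtain ⟨i, hi⟩ := Function.ne_iff.1 hx0
    exact sum_pos' (fun _ _ => sq_nonneg _) ⟨i, mem_univ i, by have : x i ≠ 0 := hi; positivity⟩
  -- The colour class of larger mass is the one satisfying `C`.
  obtain ⟨C, hC, hqp⟩ : ∃ C : V → Prop,
      (∀ i j, T.undirected.Adj i j → (C i ↔ ¬ C j)) ∧
        (∑ i, if C i then 0 else x i ^ 2) ≤ ∑ i, if C i then x i ^ 2 else 0 := by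
    obtain ⟨D, hD⟩ : ∃ D : V → Prop, ∀ i j, T.undirected.Adj i j → (D i ↔ ¬ D j) := by
      let f := SimpleGraph.IsTree.coloringTwo hT
      refine ⟨fun i => f i = 0, fun i j h => ?_⟩
      have := f.valid (show T.underlying.Adj i j from Or.inr (Or.inr h))
      change f i = 0 ↔ ¬ f j = 0
      generalize f i = a at *
      generalize f j = b at *
      omega
    rcases le_total (∑ i, if D i then 0 else x i ^ 2) (∑ i, if D i then x i ^ 2 else 0) with h | h
    · exact ⟨D, hD, h⟩
    · refine ⟨fun i => ¬ D i, fun i j hij => not_congr (hD i j hij), ?_⟩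
      refine (sum_congr rfl fun i _ => ?_).trans_le (h.trans_eq (sum_congr rfl fun i _ => ?_)) <;>
        by_cases hi : D i <;> simp [hi]
  have hCS := T.sq_sum_undirected_le C hC x
  set p : ℝ := ∑ i, if C i then x i ^ 2 else 0 with hp
  set q : ℝ := ∑ i, if C i then 0 else x i ^ 2 with hq
  have hpq : ∑ i, x i ^ 2 = p + q := by
    rw [hp, hq, ← sum_add_distrib]
    exact sum_congr rfl fun i _ => by split_ifs <;> simp
  have hq0 : 0 ≤ q := sum_nonneg fun i _ => by split_ifs <;> positivity
  have hle : ∀ i, x i ^ 2 ≤ p := by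
    intro i
    by_cases hi : C i
    · have := single_le_sum (f := fun i => if C i then x i ^ 2 else 0)
        (fun j _ => by split_ifs <;> positivity) (mem_univ i)
      simpa [hi] using this
    · refine le_trans ?_ hqp
      have := single_le_sum (f := fun i => if C i then 0 else x i ^ 2)
        (fun j _ => by split_ifs <;> positivity) (mem_univ i)
      simpa [hi] using this
  have hdeg := hT.sum_outDegree_mul_le (fun i => x i ^ 2) (fun i => sq_nonneg _) hqp hq0 hpq hle
  have hB := add_mul_le_treeBound (α := α) (n := Fintype.card V) (Nat.cast_nonneg _)
    (hq0.trans hqp) hq0 hCS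
  refine le_of_mul_le_mul_right ?_ hpos
  rw [hform, hpq]
  refine le_trans ?_ hB
  have := mul_le_mul_of_nonneg_left hdeg hα.1
  linarith

/-! ### Sharpness -/

/-- A vertex of out-degree `n - 1` is the centre of a star without incoming arcs. The eigenvector
for the bound `B` takes the value `B - α` at the centre, `1 - α` at the leaves joined to it by an
undirected edge, and `0` at the other leaves, whose rows in `A_α` vanish. -/
theorem IsMixedTree.treeBound_mem [Fintype V] [DecidableEq V] {T : MixedGraph V}
    (hT : T.IsMixedTree) {α : ℝ} (hα : 0 ≤ α) {c : V} (hV : 2 ≤ Fintype.card V)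
    (hc : T.outDegree c = Fintype.card V - 1) :
    treeBound α (Fintype.card V) T.undirected.edgeSet.ncard ∈ T.alphaEigenvalues α := by
  classical
  have hout : ∀ j, j ≠ c → T.Out c j := by
    have h : {j : V | T.Out c j} = {c}ᶜ := by
      refine Set.eq_of_subset_of_ncard_le (fun j hj => ?_) ?_
      · rintro rfl
        exact T.underlying.irrefl hj.underlying_adj
      · rw [Set.ncard_compl, Set.ncard_singleton, Nat.card_eq_fintype_card]
        exact hc.ge
    intro j hj
    exact h.ge hj
  have hcc : ¬ T.Out c c := fun h => T.underlying.irrefl h.underlying_adj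
  have hleaf : ∀ j, j ≠ c → ∀ k, T.Out j k ↔ k = c ∧ T.undirected.Adj j c := by
    intro j hj k
    have hadj : T.underlying.Adj j c := (hout j hj).underlying_adj.symm
    have hd : T.underlying.degree j ≤ 1 := by
      have h1 := SimpleGraph.IsTree.degree_add_degree_le hT hj
      have h2 := T.outDegree_le_degree c
      omega
    constructor
    · intro h
      have hkc : k = c := by
        rw [← SimpleGraph.card_neighborFinset_eq_degree] at hd
        exact card_le_one.1 hd k (by simpa using h.underlying_adj) c (by simpa using hadj)
      subst hkc
      refine ⟨rfl, h.resolve_left fun h1 => ?_⟩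
      rcases hout j hj with h2 | h2
      · exact T.arc_asymm _ _ h1 h2
      · exact T.arc_not_undirected _ _ h1 h2.symm
    · rintro ⟨rfl, h⟩
      exact Or.inr h
  have hdeg : ∀ j, j ≠ c → T.outDegree j = if T.undirected.Adj j c then 1 else 0 := by
    intro j hj
    rw [outDegree_eq_sum]
    simp only [hleaf j hj]
    by_cases h : T.undirected.Adj j c <;> simp [h]
  have hu : ∑ j ∈ univ.erase c, (if T.undirected.Adj j c then 1 else 0) =
      T.undirected.edgeSet.ncard := by
    have h1 := T.sum_outDegree
    rw [← add_sum_erase univ _ (mem_univ c), hc,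
      sum_congr rfl fun j hj => hdeg j (ne_of_mem_erase hj)] at h1
    have h2 := hT.size_add_one
    omega
  have hu' : ∑ j ∈ univ.erase c, (if T.undirected.Adj j c then (1 : ℝ) else 0) =
      T.undirected.edgeSet.ncard := by exact_mod_cast hu
  have hcR : (T.outDegree c : ℝ) = Fintype.card V - 1 := by
    rw [hc, Nat.cast_sub (by omega), Nat.cast_one]
  have hB := treeBound_sub_mul_sub (α := α) (n := Fintype.card V)
    (Nat.cast_nonneg (T.undirected.edgeSet.ncard))
  have hrow : ∀ (x : V → ℝ) (i : V), (T.alphaMatrix α).mulVec x i =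
      α * (T.outDegree i * x i) + (1 - α) * ∑ j, (if T.Out i j then 1 else 0) * x j := by
    intro x i
    rw [alphaMatrix, Matrix.add_mulVec, Matrix.smul_mulVec, Matrix.smul_mulVec, Pi.add_apply,
      Pi.smul_apply, Pi.smul_apply, outDegreeMatrix, Matrix.mulVec_diagonal, Matrix.mulVec,
      dotProduct]
    simp only [smul_eq_mul, adjMatrix, Matrix.of_apply]
  have h1 := mul_sub_one_le_treeBound (α := α) (n := Fintype.card V)
    (Nat.cast_nonneg (T.undirected.edgeSet.ncard))
  set B := treeBound α (Fintype.card V) T.undirected.edgeSet.ncard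
  -- It suffices to find an eigenvector with values `s` at the centre, `t` at the leaves joined to
  -- it by an edge and `0` elsewhere.
  have hvec : ∀ s t : ℝ, s ≠ 0 →
      α * ((Fintype.card V - 1) * s) + (1 - α) * (T.undirected.edgeSet.ncard * t) = B * s →
      (T.undirected.edgeSet.ncard ≠ 0 → α * t + (1 - α) * s = B * t) →
      B ∈ T.alphaEigenvalues α := by
    intro s t hs hcentre hleaves
    let x : V → ℝ := fun j => if j = c then s else if T.undirected.Adj j c then t else 0
    refine Module.End.hasEigenvalue_of_hasEigenvector (x := x)
      ⟨Module.End.mem_eigenspace_iff.2 ?_, fun h => hs ?_⟩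
    · ext i
      rw [Matrix.toLin'_apply, hrow, Pi.smul_apply, smul_eq_mul]
      by_cases hi : i = c
      · subst hi
        have hxi : x i = s := if_pos rfl
        have hsum : ∑ j, (if T.Out i j then 1 else 0) * x j =
            T.undirected.edgeSet.ncard * t := by
          rw [← add_sum_erase univ _ (mem_univ i), if_neg hcc, zero_mul, zero_add, ← hu', sum_mul]
          refine sum_congr rfl fun j hj => ?_
          have hj := ne_of_mem_erase hj
          simp [x, hj, hout j hj]
        rw [hsum, hxi, hcR, hcentre]
      · have hxi : x i = if T.undirected.Adj i c then t else 0 := if_neg hi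
        have hsum : ∑ j, (if T.Out i j then 1 else 0) * x j =
            if T.undirected.Adj i c then s else 0 := by
          rw [sum_eq_single c (fun j _ hj => by simp [hleaf i hi, hj]) (by simp)]
          simp [x, hleaf i hi]
        rw [hsum, hxi, hdeg i hi]
        by_cases h : T.undirected.Adj i c
        · have : T.undirected.edgeSet.ncard ≠ 0 :=
            Set.ncard_ne_zero_of_mem (a := s(i, c)) h
          simpa [h] using hleaves this
        · simp [h]
    · simpa [x] using congrFun h c
  by_cases hBα : B = α
  · -- Here the vector with `s = B - α` may vanish; the indicator of the centre is an eigenvector.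
    have h2 : (2 : ℝ) ≤ Fintype.card V := by exact_mod_cast hV
    refine hvec 1 0 one_ne_zero ?_ fun hne => ?_
    · nlinarith
    · have : (1 - α) ^ 2 * (T.undirected.edgeSet.ncard : ℝ) = 0 := by rw [← hB, hBα]; ring
      have : (1 - α) = 0 := by simpa [hne] using this
      simp [this]
  · refine hvec (B - α) (1 - α) (sub_ne_zero.2 hBα) ?_ fun _ => by ring
    linarith

end MixedGraph

theorem theorem1p1 {V : Type*} [Fintype V] [DecidableEq V] (T : MixedGraph V)
    (hT : T.IsMixedTree) (n m : ℕ) (hn : Fintype.card V = n) (hm : T.size = m)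
    (α : ℝ) (hα : α ∈ Set.Icc (0 : ℝ) 1) :
    IsGreatest (T.alphaEigenvalues α) (T.alphaSpectralRadius α) ∧
    T.alphaSpectralRadius α ≤
      1 / 2 * (α * n + Real.sqrt (α ^ 2 * (n : ℝ) ^ 2 - 4 * α ^ 2 * ((n : ℝ) - 1)
        + 4 * (1 - α) ^ 2 * ((m : ℝ) - n + 1))) ∧
    (2 ≤ n → T.IsMixedStar → T.maxOutDegree = n - 1 →
      T.alphaSpectralRadius α =
        1 / 2 * (α * n + Real.sqrt (α ^ 2 * (n : ℝ) ^ 2 - 4 * α ^ 2 * ((n : ℝ) - 1)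
          + 4 * (1 - α) ^ 2 * ((m : ℝ) - n + 1)))) := by
  have hgr := hT.isGreatest_alphaSpectralRadius α
  have hu : (m : ℝ) - n + 1 = T.undirected.edgeSet.ncard := by
    have h : (T.size : ℝ) + 1 = Fintype.card V + T.undirected.edgeSet.ncard := by
      exact_mod_cast hT.size_add_one
    rw [hm, hn] at h
    linarith
  rw [hu]
  have hle := hT.le_treeBound_of_mem hα hgr.1
  rw [hn] at hle
  refine ⟨hgr, hle, fun h2 _ hmax => le_antisymm hle (hgr.2 ?_)⟩
  have : Nonempty V := SimpleGraph.Connected.nonempty hT.connected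
  obtain ⟨c, -, hc⟩ := Finset.exists_mem_eq_sup Finset.univ Finset.univ_nonempty T.outDegree
  subst hn
  exact hT.treeBound_mem hα.1 h2 (hc.symm.trans hmax)
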